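/- Let $f:\mathbb{C}\to\mathbb{C}$ be a transcendental entire function, that is, an entire function that is not a polynomial. Let $D_r(\infty)$ denote the open ball of radius $r$ about $\infty$ in the Riemann sphere $\widehat{\mathbb{C}}=\mathbb{C}\cup\{\infty\}$ with respect to the spherical metric. The point $\infty$ is called the Baker omitted value (bov) of $f$ if $\infty$ is omitted by $f$ (which is automatic for an entire function) and there exists $r_0>0$ such that for all $r$ with $0<r<r_0$ every connected component of the boundary, taken in $\mathbb{C}$, of $f^{-1}(D_r(\infty))$ is bounded. Then $\infty$ is the bov of $f$ if and only if, for every unbounded curve $\gamma$ (a continuous map $\gamma:[0,\infty)\to\mathbb{C}$ with unbounded image), the set $f(\gamma)$ is unbounded. -/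

import Mathlib

open Set Bornology

noncomputable section

/-- A transcendental entire function: holomorphic on the whole plane and not a polynomial. -/
def IsTranscendentalEntire (f : ℂ → ℂ) : Prop :=
  Differentiable ℂ f ∧ ¬ ∃ p : Polynomial ℂ, ∀ z, f z = p.eval z

/-- The spherical (great-circle) distance on the Riemann sphere `OnePoint ℂ = ℂ ∪ {∞}`, identified
with the unit sphere by stereographic projection: `2 arcsin (c / 2)`, where
`c = 2 |z - w| / (√(1 + |z|²) √(1 + |w|²))` (and `c = 2 / √(1 + |z|²)` if `w = ∞`)
is the chordal distance. -/
def sphericalDist : OnePoint ℂ → OnePoint ℂ → ℝ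
  | some z, some w =>
      2 * Real.arcsin (‖z - w‖ / (Real.sqrt (1 + ‖z‖ ^ 2) * Real.sqrt (1 + ‖w‖ ^ 2)))
  | some z, none => 2 * Real.arcsin (1 / Real.sqrt (1 + ‖z‖ ^ 2))
  | none, some w => 2 * Real.arcsin (1 / Real.sqrt (1 + ‖w‖ ^ 2))
  | none, none => 0

/-- The open ball `D_r(a)` of the Riemann sphere for the spherical metric. -/
def sphericalBall (a : OnePoint ℂ) (r : ℝ) : Set (OnePoint ℂ) :=
  {w | sphericalDist w a < r}

/-- `a` is an omitted value of `f : ℂ → ℂ ∪ {∞}`. -/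
def IsOmittedValue (f : ℂ → OnePoint ℂ) (a : OnePoint ℂ) : Prop :=
  ∀ z : ℂ, f z ≠ a

/-- `a` is a Baker omitted value (bov) of `f : ℂ → ℂ ∪ {∞}`: it is omitted, and for all
sufficiently small `r > 0` every connected component of the boundary (in the plane) of
`f ⁻¹ (D_r(a))` is bounded. -/
def IsBakerOmittedValue (f : ℂ → OnePoint ℂ) (a : OnePoint ℂ) : Prop :=
  IsOmittedValue f a ∧
    ∃ r₀ : ℝ, 0 < r₀ ∧ ∀ r : ℝ, 0 < r → r < r₀ →
      ∀ z ∈ frontier (f ⁻¹' sphericalBall a r),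
        IsBounded (connectedComponentIn (frontier (f ⁻¹' sphericalBall a r)) z)

end

open Filter Topology

/-! Let `G = {R < ‖f‖}`; small spherical balls about `∞` pull back to such sets. Suppose `‖f‖ < R`
on an unbounded connected set, and let `U` be the component of the complement of `closure G`
containing it. A frontier point of `U` lies in a compact piece `A` of `frontier G`, split off
because boundary components are bounded. By the maximum principle `A` cannot enclose a point of `G`,
so nearby points of `G` and `U` can be joined avoiding `A`, and also avoiding the rest of the
frontier; Janiszewski's theorem forbids this. Conversely, `f` is bounded on the boundary, so an
unbounded boundary component thickens to a path connected open set containing an unbounded curve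
with bounded image. -/

/-- Janiszewski's theorem: if the boundary of an open subset `G` of the plane is the union of two
disjoint closed sets, and two points can be joined by connected sets avoiding either of these,
then both points lie in `G` or neither does. -/
theorem mem_of_frontier_eq_union {G A B S T : Set ℂ} (hA : IsClosed A)
    (hB : IsClosed B) (hAB : Disjoint A B) (hfr : frontier G = A ∪ B)
    (hS : IsPreconnected S) (hSA : Disjoint S A) (hT : IsPreconnected T) (hTB : Disjoint T B)
    {p q : ℂ} (hpS : p ∈ S) (hqS : q ∈ S) (hpT : p ∈ T) (hqT : q ∈ T) (hp : p ∈ G) : q ∈ G := by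
  classical
  obtain ⟨φ, hφB, hφA, -⟩ := exists_continuous_zero_one_of_isClosed hB hA hAB.symm
  set c : ℂ := 2 * Real.pi * Complex.I with hc
  have hc0 : c ≠ 0 := Complex.two_pi_I_ne_zero
  have hφc : Continuous fun z => (φ z : ℂ) := Complex.continuous_ofReal.comp φ.continuous
  -- Continuous across `frontier G` because `φ` is 0 or 1 there; its logarithm `L` exists since the
  -- plane is simply connected.
  let h : ℂ → ℂ := fun z => if z ∈ G then Complex.exp (c * φ z) else 1
  have hcont : Continuous h := by
    refine Continuous.if (fun z hz => ?_) (by fun_prop) continuous_const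
    have hz' : z ∈ A ∪ B := hfr ▸ hz
    rcases hz' with hz' | hz'
    · have : φ z = 1 := hφA hz'
      simp [this, hc, Complex.exp_two_pi_mul_I]
    · have : φ z = 0 := hφB hz'
      simp [this]
  have h0 : ∀ z, h z ≠ 0 := fun z => by
    by_cases hz : z ∈ G <;> simp [h, hz, Complex.exp_ne_zero]
  have hsc : IsSimplyConnected (univ : Set ℂ) :=
    have : ContractibleSpace (univ : Set ℂ) := convex_univ.contractibleSpace univ_nonempty
    SimplyConnectedSpace.ofContractible _
  obtain ⟨L, hLc, hL⟩ := Complex.exists_continuousOn_eqOn_exp_comp hsc isOpen_univ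
    hcont.continuousOn (by rintro ⟨z, -, hz⟩; exact h0 z hz)
  have hLc : Continuous L := continuousOn_univ.mp hLc
  have hL : ∀ z, Complex.exp (L z) = h z := fun z => hL (mem_univ z)
  -- Both are integer valued and `n - m` is the indicator of `G`; `n` can jump only on `A`, `m` only
  -- on `B`.
  let n : ℂ → ℂ := fun z => (if z ∈ G then (φ z : ℂ) else 0) - L z / c
  let m : ℂ → ℂ := fun z => (if z ∈ G then (φ z : ℂ) - 1 else 0) - L z / c
  have hdisc : IsDiscrete (range ((↑) : ℤ → ℂ)) :=
    (Complex.isUniformEmbedding_ofReal.isEmbedding.comp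
      Int.isClosedEmbedding_coe_real.isEmbedding).isDiscrete_range
  have hn : ∀ z, n z ∈ range ((↑) : ℤ → ℂ) := fun z => by
    have : Complex.exp (c * n z) = 1 := by
      by_cases hz : z ∈ G
      · simp [n, hz, mul_sub, mul_div_cancel₀ _ hc0, Complex.exp_sub, hL, h, Complex.exp_ne_zero]
      · simp [n, hz, mul_div_cancel₀ _ hc0, Complex.exp_neg, hL, h]
    obtain ⟨k, hk⟩ := Complex.exp_eq_one_iff.mp this
    refine ⟨k, ?_⟩
    rw [mul_comm] at hk
    exact (mul_right_cancel₀ hc0 hk).symm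
  have hm : ∀ z, m z ∈ range ((↑) : ℤ → ℂ) := fun z => by
    obtain ⟨k, hk⟩ := hn z
    by_cases hz : z ∈ G
    · refine ⟨k - 1, ?_⟩
      simp [hk, m, n, hz]; ring
    · exact ⟨k, by simp [hk, m, n, hz]⟩
  have hnS : ContinuousOn n S := by
    refine ContinuousOn.sub (ContinuousOn.if ?_ hφc.continuousOn continuousOn_const)
      (hLc.div_const c).continuousOn
    rintro z ⟨hzS, hz⟩
    have hz' : z ∈ A ∪ B := hfr ▸ hz
    have : φ z = 0 := hφB (hz'.resolve_left (disjoint_left.mp hSA hzS))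
    simp [this]
  have hmT : ContinuousOn m T := by
    refine ContinuousOn.sub (ContinuousOn.if ?_ (hφc.sub continuous_const).continuousOn
      continuousOn_const) (hLc.div_const c).continuousOn
    rintro z ⟨hzT, hz⟩
    have hz' : z ∈ A ∪ B := hfr ▸ hz
    have : φ z = 1 := hφA (hz'.resolve_right (disjoint_left.mp hTB hzT))
    simp [this]
  have e1 := hS.constant_of_mapsTo hdisc hnS (fun z _ => hn z) hpS hqS
  have e2 := hT.constant_of_mapsTo hdisc hmT (fun z _ => hm z) hpT hqT
  by_contra hq
  simp only [n, hp, hq, if_true, if_false] at e1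
  simp only [m, hp, hq, if_true, if_false] at e2
  have : (1 : ℂ) = 0 := by linear_combination e1 - e2
  exact one_ne_zero this

theorem isPreconnected_setOf_lt_norm {N : ℝ} (hN : 0 < N) :
    IsPreconnected {z : ℂ | N < ‖z‖} := by
  have : {z : ℂ | N < ‖z‖} = Complex.exp '' {z : ℂ | Real.log N < z.re} := by
    ext z
    constructor
    · intro (hz : N < ‖z‖)
      have h0 : z ≠ 0 := norm_pos_iff.mp (hN.trans hz)
      refine ⟨Complex.log z, ?_, Complex.exp_log h0⟩
      simpa [Complex.log_re] using Real.log_lt_log hN hz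
    · rintro ⟨w, hw, rfl⟩
      simpa [Complex.norm_exp] using (Real.log_lt_iff_lt_exp hN).mp hw
  rw [this]
  exact (convex_halfSpace_re_gt _).isPreconnected.image _ Complex.continuous_exp.continuousOn

theorem disjoint_frontier_connectedComponentIn {X : Type*} [TopologicalSpace X]
    [LocallyConnectedSpace X] {O : Set X} (hO : IsOpen O) (x : X) :
    Disjoint (frontier (connectedComponentIn O x)) O := by
  rw [disjoint_left]
  intro y hy hyO
  rw [hO.connectedComponentIn.frontier_eq] at hy
  obtain ⟨w, hw, hw'⟩ := mem_closure_iff.mp hy.1 _ hO.connectedComponentIn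
    (mem_connectedComponentIn hyO)
  apply hy.2
  rw [connectedComponentIn_eq hw', ← connectedComponentIn_eq hw]
  exact mem_connectedComponentIn hyO

/-- A bounded component of a closed set is contained in a compact relatively open piece of it. -/
theorem exists_isCompact_union_isClosed {X : Type*} [MetricSpace X] [ProperSpace X]
    {C : Set X} (hC : IsClosed C) {x : X} (hx : x ∈ C)
    (hb : IsBounded (connectedComponentIn C x)) :
    ∃ A B : Set X, IsCompact A ∧ IsClosed B ∧ Disjoint A B ∧ C = A ∪ B ∧ x ∈ A := by
  obtain ⟨N, hN⟩ := hb.subset_ball x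
  have hKc : IsCompact (C ∩ Metric.closedBall x N) := (isCompact_closedBall x N).inter_left hC
  set K := C ∩ Metric.closedBall x N with hK
  have : CompactSpace K := isCompact_iff_compactSpace.mp hKc
  have hxB : x ∈ Metric.ball x N := hN (mem_connectedComponentIn hx)
  have hxK : x ∈ K := ⟨hx, Metric.ball_subset_closedBall hxB⟩
  have hcomp : connectedComponent (⟨x, hxK⟩ : K) ⊆ (↑) ⁻¹' Metric.ball x N := by
    rw [← image_subset_iff, ← connectedComponentIn_eq_image hxK]
    exact (connectedComponentIn_mono x inter_subset_left).trans hN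
  -- By compactness, one clopen subset of `K` already lies in the open ball, hence is relatively
  -- open in `C` too.
  rw [connectedComponent_eq_iInter_isClopen] at hcomp
  have hO : IsOpen ((↑) ⁻¹' Metric.ball x N : Set K) :=
    Metric.isOpen_ball.preimage continuous_subtype_val
  have : Nonempty { s : Set K // IsClopen s ∧ (⟨x, hxK⟩ : K) ∈ s } :=
    ⟨⟨univ, isClopen_univ, mem_univ _⟩⟩
  obtain ⟨⟨s, hs, hxs⟩, hsN⟩ := exists_subset_nhds_of_compactSpace
    (V := fun s : { s : Set K // IsClopen s ∧ (⟨x, hxK⟩ : K) ∈ s } => (s : Set K))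
    (fun s t => ⟨⟨s ∩ t, s.2.1.inter t.2.1, s.2.2, t.2.2⟩, inter_subset_left, inter_subset_right⟩)
    (fun s => s.2.1.isClosed) (fun y hy => hO.mem_nhds (hcomp hy))
  obtain ⟨W, hW, rfl⟩ := isOpen_induced_iff.mp hs.isOpen
  have hA : (↑) '' ((↑) ⁻¹' W : Set K) = C ∩ (W ∩ Metric.ball x N) := by
    ext y
    constructor
    · rintro ⟨z, hz, rfl⟩
      exact ⟨z.2.1, hz, hsN hz⟩
    · rintro ⟨hyC, hyW, hyN⟩
      exact ⟨⟨y, hyC, Metric.ball_subset_closedBall hyN⟩, hyW, rfl⟩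
  refine ⟨C ∩ (W ∩ Metric.ball x N), C \ (W ∩ Metric.ball x N), ?_,
    hC.sdiff (hW.inter Metric.isOpen_ball), disjoint_sdiff_right.mono_left inter_subset_right,
    (inter_union_sdiff C _).symm, hx, hxs, hxB⟩
  rw [← hA]
  exact hs.isClosed.isCompact.image continuous_subtype_val

theorem exists_seq_of_not_isBounded {s : Set ℂ} (hs : ¬ IsBounded s) :
    ∃ z : ℕ → ℂ, ∀ n, z n ∈ s ∧ (n : ℝ) < ‖z n‖ := by
  have (n : ℕ) : ∃ w ∈ s, (n : ℝ) < ‖w‖ := by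
    by_contra! h
    exact hs (isBounded_iff_forall_norm_le.mpr ⟨n, h⟩)
  choose z hz hz' using this
  exact ⟨z, fun n => ⟨hz n, hz' n⟩⟩

/-! ### Unbounded curves -/

/-- A sequence in a path connected set is interpolated by a continuous curve in the set. -/
theorem IsPathConnected.exists_continuous_interpolating {X : Type*} [TopologicalSpace X]
    {U : Set X} (hU : IsPathConnected U) (z : ℤ → X) (hz : ∀ n, z n ∈ U) :
    ∃ γ : ℝ → X, Continuous γ ∧ (∀ t, γ t ∈ U) ∧ ∀ n : ℤ, γ n = z n := by
  have hJ (n : ℤ) : JoinedIn U (z n) (z (n + 1)) := hU.joinedIn _ (hz n) _ (hz (n + 1))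
  let P (n : ℤ) : Path (z n) (z (n + 1)) := (hJ n).somePath
  let γ : ℝ → X := fun t => (P ⌊t⌋).extend (t - ⌊t⌋)
  have heq (n : ℤ) : EqOn γ (fun t => (P n).extend (t - n)) (Icc n (n + 1)) := by
    intro t ht
    rcases ht.2.lt_or_eq with h | h
    · have : ⌊t⌋ = n := Int.floor_eq_iff.mpr ⟨ht.1, h⟩
      subst this; rfl
    · have h' : t = ((n + 1 : ℤ) : ℝ) := by push_cast; exact h
      subst h'
      simp [γ]
  have hlf : LocallyFinite fun n : ℤ => Icc (n : ℝ) (n + 1) := by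
    intro x
    refine ⟨Ioo (x - 1) (x + 1), Ioo_mem_nhds (by linarith) (by linarith),
      (finite_Icc (⌊x⌋ - 2) (⌊x⌋ + 2)).subset ?_⟩
    rintro n ⟨y, ⟨h1, h2⟩, h3, h4⟩
    have h5 := Int.floor_le x
    have h6 := Int.lt_floor_add_one x
    constructor
    · have : (⌊x⌋ : ℝ) - 2 < n := by linarith
      exact_mod_cast this.le
    · have : (n : ℝ) < ⌊x⌋ + 2 := by linarith
      exact_mod_cast this.le
  refine ⟨γ, hlf.continuous (iUnion_Icc_intCast ℝ) (fun n => isClosed_Icc) (fun n => ?_), ?_, ?_⟩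
  · refine ContinuousOn.congr ?_ (heq n)
    exact ((P n).continuous_extend.comp (continuous_id.sub continuous_const)).continuousOn
  · intro t
    have ht : t - ⌊t⌋ ∈ Icc (0 : ℝ) 1 := ⟨Int.fract_nonneg t, (Int.fract_lt_one t).le⟩
    simp only [γ]
    rw [Path.extend_apply _ ht]
    exact (hJ _).somePath_mem _
  · intro n
    simp [γ]

theorem exists_unbounded_curve_of_component {f : ℂ → ℂ} (hf : Continuous f) {F : Set ℂ} {M : ℝ}
    (hF : ∀ z ∈ F, ‖f z‖ ≤ M) {z : ℂ} (hz : z ∈ F)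
    (hK : ¬ IsBounded (connectedComponentIn F z)) :
    ∃ γ : Ici (0 : ℝ) → ℂ, Continuous γ ∧ ¬ IsBounded (range γ) ∧ IsBounded (f '' range γ) := by
  -- A component of `F` need not be path connected; components of this open neighbourhood are.
  have hO : IsOpen {w : ℂ | ‖f w‖ < M + 1} := isOpen_lt hf.norm continuous_const
  have hFO : F ⊆ {w : ℂ | ‖f w‖ < M + 1} := fun w hw => (hF w hw).trans_lt (lt_add_one M)
  have hU : IsPathConnected (connectedComponentIn {w : ℂ | ‖f w‖ < M + 1} z) :=
    hO.connectedComponentIn.isConnected_iff_isPathConnected.mp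
      (isConnected_connectedComponentIn_iff.mpr (hFO hz))
  obtain ⟨u, hu⟩ := exists_seq_of_not_isBounded hK
  obtain ⟨γ, hγ, hγU, hγu⟩ := hU.exists_continuous_interpolating (fun n => u n.natAbs)
    (fun n => connectedComponentIn_mono z hFO (hu _).1)
  refine ⟨fun t => γ t, hγ.comp continuous_subtype_val, fun hb => ?_, ?_⟩
  · obtain ⟨N, hN⟩ := isBounded_iff_forall_norm_le.mp hb
    obtain ⟨n, hn⟩ := exists_nat_ge N
    have h1 := hN (γ n) ⟨⟨n, mem_Ici.mpr n.cast_nonneg⟩, rfl⟩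
    have h2 : γ n = u n := by simpa using hγu n
    rw [h2] at h1
    linarith [(hu n).2]
  · refine isBounded_iff_forall_norm_le.mpr ⟨M + 1, ?_⟩
    rintro _ ⟨_, ⟨t, rfl⟩, rfl⟩
    have h : γ t ∈ {w : ℂ | ‖f w‖ < M + 1} := connectedComponentIn_subset _ _ (hγU t)
    exact h.le

/-! ### Maximum principle and separation -/

/-- A point outside a compact set `A` that can be joined to infinity and one at which an entire
function exceeds its bound on `A` are in the same component of the complement of `A`. -/
theorem mem_connectedComponentIn_compl_of_lt_norm {f : ℂ → ℂ} (hf : Differentiable ℂ f)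
    {A U : Set ℂ} (hA : IsCompact A) {R : ℝ} (hAR : ∀ z ∈ A, ‖f z‖ ≤ R)
    (hU : IsPreconnected U) (hUb : ¬ IsBounded U) (hUA : Disjoint U A) {p q : ℂ} (hq : q ∈ U)
    (hp : R < ‖f p‖) : q ∈ connectedComponentIn Aᶜ p := by
  have hpA : p ∈ Aᶜ := fun h => (hAR p h).not_gt hp
  have hV : ¬ IsBounded (connectedComponentIn Aᶜ p) := fun hb => by
    refine (Complex.norm_le_of_forall_mem_frontier_norm_le hb hf.diffContOnCl (C := R)
      (fun z hz => hAR z ?_) (subset_closure (mem_connectedComponentIn hpA))).not_gt hp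
    exact not_not.mp (disjoint_left.mp
      (disjoint_frontier_connectedComponentIn hA.isClosed.isOpen_compl p) hz)
  obtain ⟨N, hN⟩ := isBounded_iff_forall_norm_le.mp hA.isBounded
  obtain ⟨n, hn⟩ := exists_nat_ge (max N 1)
  have hn1 : (0 : ℝ) < n := one_pos.trans_le ((le_max_right _ _).trans hn)
  obtain ⟨u, hu⟩ := exists_seq_of_not_isBounded hUb
  obtain ⟨v, hv⟩ := exists_seq_of_not_isBounded hV
  have hEA : {z : ℂ | (n : ℝ) < ‖z‖} ⊆ Aᶜ := fun z hz hzA =>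
    (((hN z hzA).trans (le_max_left _ _)).trans hn).not_gt hz
  have h1 := (isPreconnected_setOf_lt_norm hn1).subset_connectedComponentIn (hu n).2 hEA (hv n).2
  have h2 := hU.subset_connectedComponentIn (hu n).1 hUA.subset_compl_right hq
  rwa [connectedComponentIn_eq (hv n).1, ← connectedComponentIn_eq h1]

/-- If all boundary components of `{z | R < ‖f z‖}` are bounded, then so is every connected set on
which `‖f‖ < R`. -/
theorem isBounded_of_forall_isBounded_component {f : ℂ → ℂ} (hf : Differentiable ℂ f)
    (hfb : ¬ IsBounded (range f)) {R : ℝ}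
    (hR : ∀ z ∈ frontier {z | R < ‖f z‖},
      IsBounded (connectedComponentIn (frontier {z | R < ‖f z‖}) z))
    {S : Set ℂ} (hS : IsPreconnected S) (hSR : ∀ z ∈ S, ‖f z‖ < R) : IsBounded S := by
  by_contra hSb
  set G := {z | R < ‖f z‖} with hGdef
  have hG : IsOpen G := isOpen_lt continuous_const hf.continuous.norm
  have hle : ∀ z ∈ frontier G, ‖f z‖ ≤ R := fun z hz =>
    not_lt.mp fun h => (hG.frontier_eq ▸ hz).2 h
  have hge : closure G ⊆ {z | R ≤ ‖f z‖} :=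
    closure_minimal (fun z (hz : R < ‖f z‖) => hz.le)
      (isClosed_le continuous_const hf.continuous.norm)
  obtain ⟨s, hs⟩ : S.Nonempty := nonempty_iff_ne_empty.mpr fun h => hSb (h ▸ isBounded_empty)
  obtain ⟨g, hg⟩ : G.Nonempty := by
    by_contra! h
    refine hfb (isBounded_iff_forall_norm_le.mpr ⟨R, ?_⟩)
    rintro _ ⟨z, rfl⟩
    exact not_lt.mp fun hz => (h ▸ (show z ∈ G from hz) : z ∈ (∅ : Set ℂ))
  have hSG : S ⊆ (closure G)ᶜ := fun z hz h => (hSR z hz).not_ge (hge h)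
  have hO : IsOpen (closure G)ᶜ := isClosed_closure.isOpen_compl
  set U := connectedComponentIn (closure G)ᶜ s with hUdef
  have hUb : ¬ IsBounded U := fun h => hSb (h.subset (hS.subset_connectedComponentIn hs hSG))
  have hUG : U ⊆ (closure G)ᶜ := connectedComponentIn_subset _ _
  have hsU : s ∈ U := mem_connectedComponentIn (hSG hs)
  obtain ⟨z, hz⟩ : (frontier U).Nonempty := by
    rw [nonempty_iff_ne_empty, Ne, frontier_eq_empty_iff]
    rintro (h | h)
    · exact (h ▸ hsU : s ∈ (∅ : Set ℂ))
    · exact hUG (h ▸ mem_univ g) (subset_closure hg)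
  have hzG : z ∈ frontier G := by
    refine hG.frontier_eq ▸ ⟨not_not.mp (disjoint_left.mp
      (disjoint_frontier_connectedComponentIn hO s) hz), fun h => ?_⟩
    obtain ⟨w, hw, hw'⟩ := mem_closure_iff.mp (frontier_subset_closure hz) G hG h
    exact hUG hw' (subset_closure hw)
  obtain ⟨A, B, hA, hB, hAB, hfr, hzA⟩ :=
    exists_isCompact_union_isClosed isClosed_frontier hzG (hR z hzG)
  -- This ball is the connected set joining `p` to `q` off `B`.
  obtain ⟨ε, hε, hball⟩ := Metric.isOpen_iff.mp hB.isOpen_compl z (disjoint_left.mp hAB hzA)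
  have hzb : Metric.ball z ε ∈ 𝓝 z := Metric.ball_mem_nhds z hε
  obtain ⟨p, hpb, hpG⟩ := mem_closure_iff_nhds.mp (frontier_subset_closure hzG) _ hzb
  obtain ⟨q, hqb, hqU⟩ := mem_closure_iff_nhds.mp (frontier_subset_closure hz) _ hzb
  have hAG : A ⊆ frontier G := hfr ▸ subset_union_left
  have hUA : Disjoint U A := disjoint_left.mpr fun w hw hwA =>
    hUG hw (frontier_subset_closure (hAG hwA))
  have hqV := mem_connectedComponentIn_compl_of_lt_norm hf hA (fun w hw => hle w (hAG hw))
    isPreconnected_connectedComponentIn hUb hUA hqU hpG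
  have hpV := mem_connectedComponentIn (connectedComponentIn_nonempty_iff.mp ⟨q, hqV⟩)
  refine hUG hqU (subset_closure ?_)
  exact mem_of_frontier_eq_union hA.isClosed hB hAB hfr isPreconnected_connectedComponentIn
    (disjoint_left.mpr fun w hw => connectedComponentIn_subset _ _ hw)
    (convex_ball z ε).isPreconnected (disjoint_left.mpr fun w hw => hball hw)
    hpV hqV hpb hqb hpG

/-! ### Spherical balls about infinity -/

theorem mem_sphericalBall_infty {w : ℂ} {r : ℝ} :
    (w : OnePoint ℂ) ∈ sphericalBall OnePoint.infty r ↔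
      2 * Real.arcsin (1 / √(1 + ‖w‖ ^ 2)) < r := Iff.rfl

theorem inv_sqrt_one_add_sq_mem_Icc (x : ℝ) : 1 / √(1 + x ^ 2) ∈ Icc (-1 : ℝ) 1 := by
  have h : 1 ≤ √(1 + x ^ 2) := Real.one_le_sqrt.mpr (by nlinarith [sq_nonneg x])
  have h0 : 0 < √(1 + x ^ 2) := one_pos.trans_le h
  exact ⟨by linarith [one_div_pos.mpr h0], (div_le_one h0).mpr h⟩

theorem mem_sphericalBall_infty_iff_lt_norm {w : ℂ} {R : ℝ} (hR : 0 ≤ R) :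
    (w : OnePoint ℂ) ∈ sphericalBall OnePoint.infty (2 * Real.arcsin (1 / √(1 + R ^ 2))) ↔
      R < ‖w‖ := by
  rw [mem_sphericalBall_infty, mul_lt_mul_iff_right₀ two_pos,
    Real.strictMonoOn_arcsin.lt_iff_lt (inv_sqrt_one_add_sq_mem_Icc _)
      (inv_sqrt_one_add_sq_mem_Icc _), one_div_lt_one_div (by positivity) (by positivity),
    Real.sqrt_lt_sqrt_iff (by positivity), add_lt_add_iff_left,
    sq_lt_sq₀ hR (norm_nonneg w)]

/-- The sharp bound is `cot (r / 2)`; this cruder one suffices. -/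
theorem le_one_div_sin_of_le_arcsin {x r : ℝ} (h0 : 0 < r) (hπ : r < Real.pi)
    (h : r ≤ 2 * Real.arcsin (1 / √(1 + x ^ 2))) : x ≤ 1 / Real.sin (r / 2) := by
  have hs : 0 < Real.sin (r / 2) := Real.sin_pos_of_pos_of_lt_pi (by linarith) (by linarith)
  have h1 : Real.sin (r / 2) ≤ 1 / √(1 + x ^ 2) :=
    (Real.le_arcsin_iff_sin_le ⟨by linarith, by linarith⟩
      (inv_sqrt_one_add_sq_mem_Icc x)).mp (by linarith)
  calc x ≤ √(1 + x ^ 2) := Real.le_sqrt_of_sq_le (by linarith)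
    _ ≤ 1 / Real.sin (r / 2) := (le_one_div (by positivity) hs).mpr h1

theorem exists_gt_arcsin_lt (M : ℝ) {r : ℝ} (hr : 0 < r) :
    ∃ R, 0 < R ∧ M < R ∧ 2 * Real.arcsin (1 / √(1 + R ^ 2)) < r := by
  have h1 : Tendsto (fun R : ℝ => 1 + R ^ 2) atTop atTop :=
    tendsto_atTop_add_const_left _ _ (tendsto_pow_atTop two_ne_zero)
  have h2 : Tendsto (fun R : ℝ => 1 / √(1 + R ^ 2)) atTop (𝓝 0) := by
    simpa only [one_div] using! (Real.tendsto_sqrt_atTop.comp h1).inv_tendsto_atTop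
  have h3 : Tendsto (fun R : ℝ => 2 * Real.arcsin (1 / √(1 + R ^ 2))) atTop (𝓝 0) := by
    simpa using ((Real.continuous_arcsin.tendsto 0).comp h2).const_mul 2
  obtain ⟨R, hR⟩ := ((eventually_gt_atTop 0).and
    ((eventually_gt_atTop M).and (h3.eventually (gt_mem_nhds hr)))).exists
  exact ⟨R, hR⟩

theorem IsTranscendentalEntire.not_isBounded_range {f : ℂ → ℂ} (hf : IsTranscendentalEntire f) :
    ¬ IsBounded (range f) := fun hb => by
  obtain ⟨c, hc⟩ := hf.1.exists_const_forall_eq_of_bounded hb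
  exact hf.2 ⟨Polynomial.C c, fun z => by simp [hc]⟩

theorem mainTheorem1 (f : ℂ → ℂ) (hf : IsTranscendentalEntire f) :
    IsBakerOmittedValue (fun z => (f z : OnePoint ℂ)) OnePoint.infty ↔
      ∀ γ : Set.Ici (0 : ℝ) → ℂ, Continuous γ → ¬ Bornology.IsBounded (Set.range γ) →
        ¬ Bornology.IsBounded (f '' Set.range γ) := by
  constructor
  · rintro ⟨-, r₀, hr₀, H⟩ γ hγ hγb hfγ
    obtain ⟨M, hM⟩ := isBounded_iff_forall_norm_le.mp hfγ
    obtain ⟨R, hR0, hMR, hRr⟩ := exists_gt_arcsin_lt M hr₀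
    have hpre : (fun z => (f z : OnePoint ℂ)) ⁻¹'
        sphericalBall OnePoint.infty (2 * Real.arcsin (1 / √(1 + R ^ 2))) = {z | R < ‖f z‖} := by
      ext z
      exact mem_sphericalBall_infty_iff_lt_norm hR0.le
    have : PreconnectedSpace (Ici (0 : ℝ)) :=
      isPreconnected_iff_preconnectedSpace.mp isPreconnected_Ici
    have hH := H _ (mul_pos two_pos (Real.arcsin_pos.mpr (by positivity))) hRr
    rw [hpre] at hH
    refine hγb (isBounded_of_forall_isBounded_component hf.1 hf.not_isBounded_range hH
      (isPreconnected_range hγ) fun z hz => (hM _ (mem_image_of_mem f hz)).trans_lt hMR)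
  · refine fun H => ⟨fun z => OnePoint.coe_ne_infty _, Real.pi, Real.pi_pos, fun r h0 hπ z hz => ?_⟩
    by_contra hK
    have hopen : IsOpen ((fun z => (f z : OnePoint ℂ)) ⁻¹' sphericalBall OnePoint.infty r) := by
      have hc : Continuous fun z => 2 * Real.arcsin (1 / √(1 + ‖f z‖ ^ 2)) := by
        refine (Real.continuous_arcsin.comp (continuous_const.div ?_ fun z => ?_)).const_mul 2
        · exact (continuous_const.add (hf.1.continuous.norm.pow 2)).sqrt
        · positivity
      exact isOpen_lt hc continuous_const
    obtain ⟨γ, hγ, hγb, hfγ⟩ := exists_unbounded_curve_of_component hf.1.continuous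
      (M := 1 / Real.sin (r / 2)) (fun w hw => le_one_div_sin_of_le_arcsin h0 hπ
        (not_lt.mp (hopen.frontier_eq ▸ hw).2)) hz hK
    exact H γ hγ hγb hfγ
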